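/- Throughout, $r\ge 1$ is a real number, $[a,b]$ is a compact interval with $a<b$, and $[w]_+=\max\{w,0\}$. **The $HK_r$-integral.** A function $f:[a,b]\to\mathbb R$ is *$HK_r$-integrable* ($L^r$ Henstock–Kurzweil integrable) if there is $F\in L^r[a,b]$ such that for every $\varepsilon>0$ there is $\delta:[a,b]\to(0,\infty)$ with $$\sum_{i=1}^n\left(\frac1{d_i-c_i}\int_{c_i}^{d_i}\bigl|F(y)-F(x_i)-f(x_i)(y-x_i)\bigr|^r\,dy\right)^{1/r}<\varepsilon$$ for every finite collection of nonoverlapping intervals $[c_i,d_i]\subset[a,b]$, $c_i<d_i$, with tags $x_i\in[c_i,d_i]$ such that $[c_i,d_i]\subset(x_i-\delta(x_i),x_i+\delta(x_i))$ for $i=1,\dots,n$. **The $P_r$-integral.** A function $F\in L^r[a,b]$ is *$L^r$-continuous* at $x\in[a,b]$ if $$\left(\frac1h\int_{[x-h,x+h]\cap[a,b]}|F(y)-F(x)|^r\,dy\right)^{1/r}\to0\qquad(h\to0^+).$$ The *upper-right $L^r$-derivate* $D_r^+F(x)\in[-\infty,\infty]$ at $x\in[a,b)$ is the infimum of all real $\alpha$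 such that $$\left(\frac1h\int_0^h[F(x+t)-F(x)-\alpha t]_+^r\,dt\right)^{1/r}=o(h)\qquad(h\to0^+)$$ ($+\infty$ if there is no such $\alpha$), and the *upper-left $L^r$-derivate* $D_r^-F(x)$ at $x\in(a,b]$ is defined in the same way with $[F(x)-F(x-t)-\alpha t]_+$ in place of $[F(x+t)-F(x)-\alpha t]_+$. The *upper $L^r$-derivate* $\overline D_rF(x)$ is $\max\{D_r^+F(x),D_r^-F(x)\}$ for $x\in(a,b)$, $D_r^+F(a)$ for $x=a$, and $D_r^-F(b)$ for $x=b$. A function $m\in L^r[a,b]$ is an *$L^r$-minor function* of $f:[a,b]\to\mathbb R$ if $m(a)=0$, $m$ is $L^r$-continuous at every point of $[a,b]$, $\overline D_rm(x)\le f(x)$ for almost every $x\in[a,b]$, and $\overline D_rm(x)<\infty$ for all but countably many $x\in[a,b]$. A function $M$ is an *$L^r$-major function* of $f$ if $-M$ is an $L^r$-minor function of $-f$. Finally, $f$ is *$P_r$-integrable* if for every $\varepsilon>0$ there are an $L^r$-major function $M$ and an $L^r$-minor function $m$ of $f$ with $M(b)-m(b)<\varepsilon$. **Theorem.** For every real $r\ge1$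 there exists a function $f:[0,1]\to\mathbb R$ that is $HK_r$-integrable on $[0,1]$ but not $P_1$-integrable on $[0,1]$. -/

import Mathlib

open Set Filter Topology MeasureTheory Asymptotics

/-! A function on `[a, b]` is represented by a function `ℝ → ℝ`; none of the notions below depends
on its values outside `[a, b]`. The exponent `r` is a real number with `1 ≤ r`. -/

namespace LrIntegral

/-- `F ∈ L^r[a, b]`. -/
def MemLr (r a b : ℝ) (F : ℝ → ℝ) : Prop :=
  MemLp F (ENNReal.ofReal r) (volume.restrict (Icc a b))

/-- A finite collection of tagged, pairwise nonoverlapping, nondegenerate closed subintervals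
`[c i, d i]` of `[a, b]`, with tags `x i ∈ [c i, d i]`, that is fine for the gauge `δ`. -/
structure IsFineCollection (a b : ℝ) (δ : ℝ → ℝ) {n : ℕ} (c d x : Fin n → ℝ) : Prop where
  lt : ∀ i, c i < d i
  subset : ∀ i, Icc (c i) (d i) ⊆ Icc a b
  nonoverlapping : ∀ i j, i ≠ j → Disjoint (Ioo (c i) (d i)) (Ioo (c j) (d j))
  tag_mem : ∀ i, x i ∈ Icc (c i) (d i)
  fine : ∀ i, Icc (c i) (d i) ⊆ Ioo (x i - δ (x i)) (x i + δ (x i))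

/-- `F` is an indefinite `HK_r`-integral of `f` on `[a, b]`. -/
def IsHKrPrimitive (r a b : ℝ) (f F : ℝ → ℝ) : Prop :=
  MemLr r a b F ∧
    ∀ ε : ℝ, 0 < ε → ∃ δ : ℝ → ℝ, (∀ x ∈ Icc a b, 0 < δ x) ∧
      ∀ (n : ℕ) (c d x : Fin n → ℝ), IsFineCollection a b δ c d x →
        ∑ i, (1 / (d i - c i) *
          ∫ y in (c i)..(d i), |F y - F (x i) - f (x i) * (y - x i)| ^ r) ^ (1 / r) < ε

/-- `f` is `L^r` Henstock–Kurzweil integrable on `[a, b]`. -/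
def HKrIntegrable (r a b : ℝ) (f : ℝ → ℝ) : Prop :=
  ∃ F : ℝ → ℝ, IsHKrPrimitive r a b f F

/-- `L^r`-continuity, at a point `x` of `[a, b]`, of a function on `[a, b]`. For an interior point
and small `h` the domain of integration is `[x - h, x + h]`; at an endpoint it is one-sided. -/
def LrContinuousAt (r a b : ℝ) (F : ℝ → ℝ) (x : ℝ) : Prop :=
  Tendsto (fun h : ℝ =>
      (1 / h * ∫ y in Icc (x - h) (x + h) ∩ Icc a b, |F y - F x| ^ r) ^ (1 / r))
    (𝓝[>] 0) (𝓝 0)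

/-- The upper-right `L^r`-derivate of `F` at `x`; it is `⊤` if no real `α` qualifies. -/
noncomputable def upperRightDerivate (r : ℝ) (F : ℝ → ℝ) (x : ℝ) : EReal :=
  sInf ((fun α : ℝ => (α : EReal)) '' {α : ℝ |
    (fun h : ℝ =>
      (1 / h * ∫ t in (0 : ℝ)..h, (max (F (x + t) - F x - α * t) 0) ^ r) ^ (1 / r))
      =o[𝓝[>] 0] (fun h : ℝ => h)})

/-- The upper-left `L^r`-derivate of `F` at `x`; it is `⊤` if no real `α` qualifies. -/
noncomputable def upperLeftDerivate (r : ℝ) (F : ℝ → ℝ) (x : ℝ) : EReal :=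
  sInf ((fun α : ℝ => (α : EReal)) '' {α : ℝ |
    (fun h : ℝ =>
      (1 / h * ∫ t in (0 : ℝ)..h, (max (F x - F (x - t) - α * t) 0) ^ r) ^ (1 / r))
      =o[𝓝[>] 0] (fun h : ℝ => h)})

open Classical in
/-- The (bilateral) upper `L^r`-derivate at `x ∈ [a, b]` of a function on `[a, b]`: the larger of
the upper-right and the upper-left derivate, only the one-sided one that makes sense being used
at an endpoint. -/
noncomputable def upperDerivate (r a b : ℝ) (F : ℝ → ℝ) (x : ℝ) : EReal :=
  max (if x < b then upperRightDerivate r F x else ⊥)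
    (if a < x then upperLeftDerivate r F x else ⊥)

/-- `m` is an `L^r`-minor function of `f` on `[a, b]`. -/
structure IsMinorFunction (r a b : ℝ) (f m : ℝ → ℝ) : Prop where
  memLr : MemLr r a b m
  map_left : m a = 0
  continuousAt : ∀ x ∈ Icc a b, LrContinuousAt r a b m x
  derivate_le : ∀ᵐ x ∂(volume.restrict (Icc a b)), upperDerivate r a b m x ≤ (f x : EReal)
  derivate_lt_top : {x ∈ Icc a b | ¬ upperDerivate r a b m x < ⊤}.Countable

/-- `M` is an `L^r`-major function of `f` on `[a, b]`. -/
def IsMajorFunction (r a b : ℝ) (f M : ℝ → ℝ) : Prop :=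
  IsMinorFunction r a b (fun x => -f x) (fun x => -M x)

/-- `f` is `L^r`-Perron integrable (`P_r`-integrable) on `[a, b]`. -/
def PrIntegrable (r a b : ℝ) (f : ℝ → ℝ) : Prop :=
  ∀ ε : ℝ, 0 < ε → ∃ M m : ℝ → ℝ,
    IsMajorFunction r a b f M ∧ IsMinorFunction r a b f m ∧ M b - m b < ε

end LrIntegral

/-! Put `σ = 4 ^ (-r)`. Beside a self-similar Cantor set of ratio `σ ^ 2` lie disjoint gaps indexed
by finite binary words, of length comparable to `σ ^ (2 * n)` for words of length `n`. Each gap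
carries a smooth bump of height 4 and width comparable to `σ ^ (3 * n)`. Let `F` be the sum of the
bumps and `f` its derivative in the gaps, zero elsewhere.

`F` is an `HK_r`-primitive of `f` (`BumpFamily.isHKrPrimitive_sum`). In the gaps `F` is
differentiable. An interval tagged outside the gaps is at least comparable in length to each gap
whose bump it reaches, so such a bump costs at most a constant times `(σ ^ n) ^ (1 / r) = 4 ^ (-n)`,
which is summable over the `2 ^ n` words of each length `n`.

`f` is not `P_1`-integrable. Suppose `M 1 - m 1 < 1`. By monotonicity (`SecondOrderMinor.le`), `M -
m` is nondecreasing, and so is `M` minus the bump in each gap; hence `m` follows every bump up to an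
error of 1. The Cantor set is uncountable, so `m` has finite upper derivate at one of its points
`x`. Then `m` can exceed `m x` by a fixed amount only on a set of measure `O(h ^ 2)` in `[x, x +
h]`. A gap of every generation lies to the right of `x` at a distance comparable to its length, so
width would be `O(length ^ 2)`, that is, `σ ^ (3 * n) = O(σ ^ (4 * n))`, which is false.

The monotonicity is proved on the primitive `Φ` of a minor function `m`: `L^1`-continuity gives `Φ'
= m` everywhere, and derivate bounds become one-sided second-order bounds on `Φ`. Minimising `Φ x -
s * x` for each intermediate slope `s` then contradicts those bounds. -/

namespace LrIntegral

/-! ### Monotonicity from one-sided second-order bounds on a primitive -/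

/-- `Φ (x + h) ≤ Φ x + h * g x + α * h ^ 2` for all small `h > 0`. -/
def SecondOrderBound (Φ g : ℝ → ℝ) (x α : ℝ) : Prop :=
  ∀ᶠ h in 𝓝[>] (0 : ℝ), Φ (x + h) - Φ x - h * g x ≤ α * h ^ 2

theorem SecondOrderBound.mono {Φ g : ℝ → ℝ} {x α β : ℝ} (h : SecondOrderBound Φ g x α)
    (hαβ : α ≤ β) : SecondOrderBound Φ g x β := by
  filter_upwards [h] with t ht
  nlinarith [sq_nonneg t]

theorem SecondOrderBound.add {Φ g Ψ k : ℝ → ℝ} {x α β : ℝ} (h : SecondOrderBound Φ g x α)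
    (h' : SecondOrderBound Ψ k x β) :
    SecondOrderBound (fun y => Φ y + Ψ y) (fun y => g y + k y) x (α + β) := by
  filter_upwards [h, h'] with t ht ht'
  linarith

/-- This is the proof of Darboux's theorem, keeping the global minimality that the intermediate
value statement discards. -/
theorem exists_isMinOn_sub_mul {a b : ℝ} {Φ g : ℝ → ℝ} (hab : a < b)
    (hΦ : ∀ x ∈ Icc a b, HasDerivWithinAt Φ (g x) (Icc a b) x) {s : ℝ} (ha : g a < s)
    (hb : s < g b) :
    ∃ p ∈ Ioo a b, g p = s ∧ IsMinOn (fun x => Φ x - s * x) (Icc a b) p := by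
  set k : ℝ → ℝ := fun x => Φ x - s * x
  have hk : ∀ x ∈ Icc a b, HasDerivWithinAt k (g x - s) (Icc a b) x := by
    intro x hx
    simpa using! (hΦ x hx).sub ((hasDerivWithinAt_id x _).const_mul s)
  obtain ⟨c, cmem, hc⟩ : ∃ c ∈ Icc a b, IsMinOn k (Icc a b) c :=
    isCompact_Icc.exists_isMinOn (nonempty_Icc.2 hab.le) fun x hx => (hk x hx).continuousWithinAt
  have cmem' : c ∈ Ioo a b := by
    rcases cmem.1.eq_or_lt with (rfl | hac)
    · refine absurd (sub_nonneg.1 <| nonneg_of_mul_nonneg_right ?_ (sub_pos.2 hab))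
        (not_le_of_gt ha)
      have : b - a ∈ posTangentConeAt (Icc a b) a :=
        sub_mem_posTangentConeAt_of_segment_subset (segment_eq_Icc hab.le ▸ Subset.rfl)
      simpa only [ContinuousLinearMap.smulRight_apply, one_apply_eq_self]
        using! hc.localize.hasFDerivWithinAt_nonneg (hk a (left_mem_Icc.2 hab.le)) this
    rcases cmem.2.eq_or_lt' with (rfl | hcb)
    · refine absurd (sub_nonpos.1 <| nonpos_of_mul_nonneg_right ?_ (sub_lt_zero.2 hab))
        (not_le_of_gt hb)
      have : a - b ∈ posTangentConeAt (Icc a b) b :=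
        sub_mem_posTangentConeAt_of_segment_subset (by rw [segment_symm, segment_eq_Icc hab.le])
      simpa only [ContinuousLinearMap.smulRight_apply, one_apply_eq_self]
        using! hc.localize.hasFDerivWithinAt_nonneg (hk b (right_mem_Icc.2 hab.le)) this
    exact ⟨hac, hcb⟩
  refine ⟨c, cmem', ?_, hc⟩
  rw [← sub_eq_zero]
  have : Icc a b ∈ 𝓝 c := by rwa [← mem_interior_iff_mem_nhds, interior_Icc]
  exact (hc.isLocalMin this).hasDerivAt_eq_zero ((hk c cmem).hasDerivAt this)

/-- If the derivative `g` of `Φ` increased from `a` to `b`, then `Φ` would lie above a line through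
one of its points, of slope the derivative there, for uncountably many points. -/
theorem le_of_frequently_lt {a b : ℝ} {Φ g : ℝ → ℝ} (hab : a < b)
    (hΦ : ∀ x ∈ Icc a b, HasDerivWithinAt Φ (g x) (Icc a b) x) {C : Set ℝ} (hC : C.Countable)
    (h : ∀ x ∈ Ioo a b, x ∉ C → ∃ᶠ t in 𝓝[>] (0 : ℝ), Φ (x + t) - Φ x - t * g x < 0) :
    g b ≤ g a := by
  by_contra! hlt
  -- Each intermediate slope is attained at a minimiser, where the frequent strict inequality fails;
  -- so the minimiser lies in `C`, and an interval would be covered by the countable set `g '' C`.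
  have hsub : Ioo (g a) (g b) ⊆ g '' C := by
    intro s hs
    obtain ⟨p, hp, rfl, hmin⟩ := exists_isMinOn_sub_mul hab hΦ hs.1 hs.2
    by_contra hpC
    have hp' : p ∉ C := fun hc => hpC ⟨p, hc, rfl⟩
    refine h p hp hp' ?_
    have : Ioo (0 : ℝ) (b - p) ∈ 𝓝[>] (0 : ℝ) := Ioo_mem_nhdsGT (sub_pos.2 hp.2)
    filter_upwards [this] with t ht
    have := hmin (show p + t ∈ Icc a b from ⟨by linarith [hp.1, ht.1], by linarith [ht.2]⟩)
    simp only [mem_ofPred_eq] at this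
    nlinarith
  have := (hC.image g).mono hsub
  rw [Cardinal.Real.Ioo_countable_iff] at this
  linarith

/-- A continuous increasing function of small variation whose lower right derivative is infinite on
a given null set. -/
theorem exists_monotone_superlinear {Z : Set ℝ} (hZ : volume Z = 0) {η : ℝ} (hη : 0 < η) :
    ∃ φ : ℝ → ℝ, Continuous φ ∧ Monotone φ ∧ (∀ x y, φ y - φ x ≤ η) ∧
      ∀ z ∈ Z, ∀ K : ℝ, 0 ≤ K → ∀ᶠ h in 𝓝[>] (0 : ℝ), φ z + K * h ≤ φ (z + h) := by
  -- Vitali–Carathéodory: a lower semicontinuous majorant of `∞` on the null set, with integral at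
  -- most `η`. Its primitive is `φ`; near a point of `Z` the integrand exceeds any given `K`.
  obtain ⟨G, hG, hlsc, hint⟩ := exists_le_lowerSemicontinuous_lintegral_ge volume
    ((toMeasurable volume Z).indicator fun _ => (⊤ : ENNReal))
    (measurable_const.indicator (measurableSet_toMeasurable _ _))
    (ε := ENNReal.ofReal η) (by simpa using hη)
  rw [lintegral_indicator (measurableSet_toMeasurable _ _)] at hint
  have hGm : Measurable G := hlsc.measurable
  have hint' : ∫⁻ x, G x ≤ ENNReal.ofReal η := by
    refine hint.trans (by simp [hZ])
  have hfin : ∫⁻ x, G x ≠ ⊤ := (hint'.trans_lt ENNReal.ofReal_lt_top).ne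
  have hI : Integrable (fun x => (G x).toReal) :=
    integrable_toReal_of_lintegral_ne_top hGm.aemeasurable hfin
  have hae : ∀ᵐ x, G x < ⊤ := ae_lt_top hGm hfin
  have hdiff : ∀ x y, (∫ t in (0:ℝ)..y, (G t).toReal) - ∫ t in (0:ℝ)..x, (G t).toReal
      = ∫ t in x..y, (G t).toReal := fun x y =>
    intervalIntegral.integral_interval_sub_left hI.intervalIntegrable hI.intervalIntegrable
  have hmono : Monotone fun y => ∫ t in (0:ℝ)..y, (G t).toReal := by
    intro x y hxy
    have := hdiff x y
    have h2 : 0 ≤ ∫ t in x..y, (G t).toReal :=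
      intervalIntegral.integral_nonneg hxy fun _ _ => ENNReal.toReal_nonneg
    simp only
    linarith
  refine ⟨fun y => ∫ t in (0:ℝ)..y, (G t).toReal,
    intervalIntegral.continuous_primitive (fun _ _ => hI.intervalIntegrable) 0, hmono, ?_, ?_⟩
  · intro x y
    rw [hdiff]
    have h1 : ∫ t, (G t).toReal ≤ η := by
      rw [integral_toReal hGm.aemeasurable hae]
      exact ENNReal.toReal_le_of_le_ofReal hη.le hint'
    rcases le_total x y with hxy | hxy
    · rw [intervalIntegral.integral_of_le hxy]
      exact (setIntegral_le_integral hI (ae_of_all _ fun _ => ENNReal.toReal_nonneg)).trans h1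
    · rw [intervalIntegral.integral_symm]
      have h2 : 0 ≤ ∫ t in y..x, (G t).toReal :=
        intervalIntegral.integral_nonneg hxy fun _ _ => ENNReal.toReal_nonneg
      linarith
  · intro z hz K hK
    have hGz : G z = ⊤ := by
      have := hG z
      rwa [indicator_of_mem (subset_toMeasurable _ _ hz), top_le_iff] at this
    have hev : ∀ᶠ y in 𝓝 z, ENNReal.ofReal K < G y := hlsc z _ (by simp [hGz])
    obtain ⟨δ, hδ, hball⟩ := Metric.eventually_nhds_iff.1 hev
    filter_upwards [Ioo_mem_nhdsGT hδ] with h hh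
    have : K * h ≤ ∫ t in z..(z + h), (G t).toReal := by
      have h3 : ∫ t in z..(z + h), K ≤ ∫ t in z..(z + h), (G t).toReal := by
        refine intervalIntegral.integral_mono_ae_restrict (by linarith [hh.1])
          intervalIntegrable_const hI.intervalIntegrable ?_
        filter_upwards [ae_restrict_of_ae hae, ae_restrict_mem measurableSet_Icc] with y hy hyz
        have := (hball (y := y) (by
          rw [Real.dist_eq, abs_lt]; constructor <;> linarith [hyz.1, hyz.2, hh.1, hh.2])).le
        have := ENNReal.toReal_mono hy.ne this
        rwa [ENNReal.toReal_ofReal hK] at this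
      simpa [mul_comm] using h3
    have := hdiff z (z + h)
    linarith

/-- `Φ` is a primitive of `g` on `[a, b]`, and the right second-order derivates of `Φ` satisfy the
bounds that hold for the primitive of an `L^1`-minor function `g` of `f`. -/
structure SecondOrderMinor (a b : ℝ) (f g Φ : ℝ → ℝ) : Prop where
  deriv : ∀ x ∈ Icc a b, HasDerivWithinAt Φ (g x) (Icc a b) x
  ae_bound : ∀ᵐ x, x ∈ Ioo a b → ∀ κ : ℝ, 0 < κ → SecondOrderBound Φ g x (f x / 2 + κ)
  countable : {x ∈ Ioo a b | ¬ ∃ α, SecondOrderBound Φ g x α}.Countable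

theorem SecondOrderMinor.mono {a b a' b' : ℝ} {f g Φ : ℝ → ℝ} (h : SecondOrderMinor a b f g Φ)
    (ha : a ≤ a') (hb : b' ≤ b) : SecondOrderMinor a' b' f g Φ where
  deriv x hx := (h.deriv x (Icc_subset_Icc ha hb hx)).mono (Icc_subset_Icc ha hb)
  ae_bound := by
    filter_upwards [h.ae_bound] with x hx hx'
    exact hx (Ioo_subset_Ioo ha hb hx')
  countable := by
    refine h.countable.mono ?_
    rintro x ⟨hx, hx'⟩
    exact ⟨Ioo_subset_Ioo ha hb hx, hx'⟩

theorem SecondOrderMinor.add {a b : ℝ} {f g Φ f' g' Φ' : ℝ → ℝ} (h : SecondOrderMinor a b f g Φ)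
    (h' : SecondOrderMinor a b f' g' Φ') :
    SecondOrderMinor a b (fun x => f x + f' x) (fun x => g x + g' x) (fun x => Φ x + Φ' x) where
  deriv x hx := (h.deriv x hx).add (h'.deriv x hx)
  ae_bound := by
    filter_upwards [h.ae_bound, h'.ae_bound] with x hx hx' hab κ hκ
    exact ((hx hab (κ / 2) (by linarith)).add (hx' hab (κ / 2) (by linarith))).mono (by linarith)
  countable := by
    refine (h.countable.union h'.countable).mono fun x hx => ?_
    by_contra hc
    simp only [mem_union, mem_ofPred_eq, not_or, not_and, not_not] at hc
    obtain ⟨α, hα⟩ := hc.1 hx.1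
    obtain ⟨β, hβ⟩ := hc.2 hx.1
    exact hx.2 ⟨_, hα.add hβ⟩

theorem integral_sub_ge_of_superlinear {φ : ℝ → ℝ} (hφ : Continuous φ) {z K h : ℝ} (hh : 0 ≤ h)
    (H : ∀ t ∈ Icc 0 h, φ z + K * t ≤ φ (z + t)) (a : ℝ) :
    h * φ z + K * h ^ 2 / 2 ≤ (∫ y in a..(z + h), φ y) - ∫ y in a..z, φ y := by
  rw [intervalIntegral.integral_interval_sub_left (hφ.intervalIntegrable _ _)
    (hφ.intervalIntegrable _ _)]
  have h1 : ∫ t in (0:ℝ)..h, (φ z + K * t) ≤ ∫ t in (0:ℝ)..h, φ (z + t) :=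
    intervalIntegral.integral_mono_on hh (Continuous.intervalIntegrable (by fun_prop) _ _)
      (Continuous.intervalIntegrable (by fun_prop) _ _) H
  rw [intervalIntegral.integral_comp_add_left, add_zero, intervalIntegral.integral_add
    intervalIntegrable_const (Continuous.intervalIntegrable (by fun_prop) _ _),
    intervalIntegral.integral_const_mul, integral_id] at h1
  simp at h1
  linarith

/-- Subtract from `Φ` the primitive of a superlinear `φ` and the term `η * x ^ 2`. The quadratic
makes the bound strict almost everywhere; at the remaining points with a finite bound `α`, the
growth of `φ` beats `α`. This costs `g` only `O(η)`. -/
theorem SecondOrderMinor.le {a b : ℝ} {f g Φ : ℝ → ℝ} (h : SecondOrderMinor a b f g Φ)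
    (hab : a < b) (hf : ∀ x ∈ Ioo a b, f x = 0) : g b ≤ g a := by
  have key : ∀ η : ℝ, 0 < η → g b ≤ g a + η * (1 + 2 * (b - a)) := by
    intro η hη
    obtain ⟨φ, hφ, hmono, hvar, hsup⟩ :=
      exists_monotone_superlinear (ae_iff.1 h.ae_bound) hη
    have h1 := le_of_frequently_lt (Φ := fun x => Φ x - (∫ y in a..x, φ y) - η * x ^ 2)
      (g := fun x => g x - φ x - η * (2 * x)) hab (fun x hx => by
        have h2 : HasDerivAt (fun x => ∫ y in a..x, φ y) (φ x) x := hφ.integral_hasStrictDerivAt a x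
          |>.hasDerivAt
        have h3 : HasDerivAt (fun x : ℝ => η * x ^ 2) (η * (2 * x)) x := by
          simpa using (hasDerivAt_pow 2 x).const_mul η
        exact ((h.deriv x hx).sub h2.hasDerivWithinAt).sub h3.hasDerivWithinAt)
      h.countable (fun x hx hxC => ?_)
    · have := hvar a b
      nlinarith
    · refine Eventually.frequently ?_
      have hx' : ∃ α, SecondOrderBound Φ g x α := by
        by_contra hc
        exact hxC ⟨hx, hc⟩
      by_cases hZ : x ∈ Ioo a b → ∀ κ : ℝ, 0 < κ → SecondOrderBound Φ g x (f x / 2 + κ)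
      · filter_upwards [hZ hx (η / 2) (by linarith), self_mem_nhdsWithin] with t ht ht0
        have := integral_sub_ge_of_superlinear hφ (K := 0) (le_of_lt ht0)
          (fun s hs => by simpa using hmono (by linarith [hs.1] : x ≤ x + s)) a
        rw [hf x hx] at ht
        nlinarith [mul_pos hη (pow_pos (mem_Ioi.1 ht0) 2)]
      · obtain ⟨α, hα⟩ := hx'
        -- Slope `2 * |α|` for `φ` integrates to a gain of `|α| * t ^ 2`, which absorbs `α * t ^ 2`.
        have hs := hsup x hZ (2 * |α|) (by positivity)
        obtain ⟨δ, hδ, hs⟩ := mem_nhdsGT_iff_exists_Ioo_subset.1 hs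
        filter_upwards [hα, Ioo_mem_nhdsGT hδ] with t ht ht0
        have := integral_sub_ge_of_superlinear hφ (K := 2 * |α|) ht0.1.le
          (fun s hs' => by
            rcases hs'.1.eq_or_lt with rfl | h0
            · simp
            · exact hs ⟨h0, hs'.2.trans_lt ht0.2⟩) a
        nlinarith [mul_pos hη (pow_pos (mem_Ioi.1 ht0.1) 2), le_abs_self α, sq_nonneg t]
  by_contra! hlt
  have hc : 0 < 1 + 2 * (b - a) := by linarith
  have := key ((g b - g a) / (2 * (1 + 2 * (b - a)))) (div_pos (by linarith) (by linarith))
  have h2 : (g b - g a) / (2 * (1 + 2 * (b - a))) * (1 + 2 * (b - a)) = (g b - g a) / 2 := by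
    field_simp
  linarith

/-! ### From `L^1`-minor functions to second-order bounds -/

theorem LrContinuousAt.eventually_integral_le {a b : ℝ} {m : ℝ → ℝ} {x : ℝ}
    (h : LrContinuousAt 1 a b m x) {κ : ℝ} (hκ : 0 < κ) :
    ∃ δ > 0, ∀ t, 0 < t → t < δ →
      ∫ y in Icc (x - t) (x + t) ∩ Icc a b, |m y - m x| ≤ κ * t := by
  have h1 := h.eventually (gt_mem_nhds hκ)
  obtain ⟨δ, hδ, hs⟩ := mem_nhdsGT_iff_exists_Ioo_subset.1 h1
  refine ⟨δ, hδ, fun t ht htδ => ?_⟩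
  have h2 := hs ⟨ht, htδ⟩
  simp only [mem_ofPred_eq, Real.rpow_one, one_div, inv_one] at h2
  rw [inv_mul_lt_iff₀ ht] at h2
  linarith

theorem LrContinuousAt.hasDerivWithinAt {a b : ℝ} {m : ℝ → ℝ} {x : ℝ} (hx : x ∈ Icc a b)
    (hm : IntegrableOn m (Icc a b)) (h : LrContinuousAt 1 a b m x) :
    HasDerivWithinAt (fun y => ∫ t in a..y, m t) (m x) (Icc a b) x := by
  have hii : ∀ u ∈ Icc a b, ∀ v ∈ Icc a b, IntervalIntegrable m volume u v := fun u hu v hv =>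
    (hm.mono_set (uIcc_subset_Icc hu hv)).intervalIntegrable
  have ha : a ∈ Icc a b := ⟨le_rfl, hx.1.trans hx.2⟩
  rw [hasDerivWithinAt_iff_isLittleO, isLittleO_iff]
  intro κ hκ
  obtain ⟨δ, hδ, H⟩ := h.eventually_integral_le hκ
  have : Metric.ball x δ ∈ 𝓝[Icc a b] x := mem_nhdsWithin_of_mem_nhds (Metric.ball_mem_nhds x hδ)
  filter_upwards [this, self_mem_nhdsWithin] with y hy hyab
  rw [Metric.mem_ball, Real.dist_eq] at hy
  rcases eq_or_ne y x with rfl | hne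
  · simp
  have hpos : 0 < |y - x| := abs_pos.2 (sub_ne_zero.2 hne)
  have h1 := H _ hpos hy
  have hsub : uIcc x y ⊆ Icc (x - |y - x|) (x + |y - x|) ∩ Icc a b := by
    refine subset_inter (uIcc_subset_Icc ⟨by linarith, by linarith⟩ ⟨?_, ?_⟩) (uIcc_subset_Icc hx hyab)
    · linarith [neg_abs_le (y - x)]
    · linarith [le_abs_self (y - x)]
  have h2 : (∫ t in a..y, m t) - (∫ t in a..x, m t) - (y - x) • m x = ∫ t in x..y, (m t - m x) := by
    rw [intervalIntegral.integral_interval_sub_left (hii _ ha _ hyab) (hii _ ha _ hx),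
      intervalIntegral.integral_sub (hii _ hx _ hyab) intervalIntegrable_const,
      intervalIntegral.integral_const]
  rw [h2, Real.norm_eq_abs (y - x)]
  refine (intervalIntegral.norm_integral_le_integral_norm_uIoc).trans (le_trans ?_ h1)
  simp only [Real.norm_eq_abs]
  refine setIntegral_mono_set ?_ (ae_of_all _ fun _ => abs_nonneg _)
    (uIoc_subset_uIcc.trans hsub).eventuallyLE
  exact ((hm.mono_set inter_subset_right).sub
    (integrableOn_const (by
      refine ne_top_of_le_ne_top ?_ (measure_mono inter_subset_right)
      simp))).abs

theorem exists_of_upperRightDerivate_lt {m : ℝ → ℝ} {x : ℝ} {c : EReal}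
    (h : upperRightDerivate 1 m x < c) :
    ∃ α : ℝ, (α : EReal) < c ∧ ∀ κ : ℝ, 0 < κ → ∀ᶠ h in 𝓝[>] (0 : ℝ),
      ∫ t in (0 : ℝ)..h, max (m (x + t) - m x - α * t) 0 ≤ κ * h ^ 2 := by
  rw [upperRightDerivate, sInf_lt_iff] at h
  obtain ⟨_, ⟨α, hα, rfl⟩, hlt⟩ := h
  refine ⟨α, hlt, fun κ hκ => ?_⟩
  filter_upwards [(isLittleO_iff.1 hα) hκ, self_mem_nhdsWithin] with t ht ht0
  have ht0 : 0 < t := ht0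
  simp only [Real.rpow_one, one_div, inv_one] at ht
  have h2 := (le_abs_self _).trans ht
  rw [Real.norm_eq_abs, abs_of_pos ht0, inv_mul_le_iff₀ ht0] at h2
  linarith

/-- Integrate `m (x + s) - m x - α * s` over `[0, t]` and bound it by its positive part; the linear
term contributes `α * t ^ 2 / 2`. -/
theorem secondOrderBound_of_integral_le {a b : ℝ} {m : ℝ → ℝ} {x : ℝ} (hx : x ∈ Ioo a b)
    (hm : IntegrableOn m (Icc a b)) {α κ : ℝ}
    (h : ∀ᶠ h in 𝓝[>] (0 : ℝ), ∫ t in (0 : ℝ)..h, max (m (x + t) - m x - α * t) 0 ≤ κ * h ^ 2) :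
    SecondOrderBound (fun y => ∫ t in a..y, m t) m x (α / 2 + κ) := by
  have hii : ∀ u ∈ Icc a b, ∀ v ∈ Icc a b, IntervalIntegrable m volume u v := fun u hu v hv =>
    (hm.mono_set (uIcc_subset_Icc hu hv)).intervalIntegrable
  have ha : a ∈ Icc a b := ⟨le_rfl, (hx.1.trans hx.2).le⟩
  filter_upwards [h, Ioo_mem_nhdsGT (sub_pos.2 hx.2)] with t ht ht0
  have hxt : x + t ∈ Icc a b := ⟨by linarith [hx.1, ht0.1], by linarith [ht0.2]⟩
  have hI := hii _ (Ioo_subset_Icc_self hx) _ hxt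
  have hI' : IntervalIntegrable (fun s => m (x + s)) volume 0 t := by
    have := hI.comp_add_left x
    simpa using this
  have hI2 : IntervalIntegrable (fun s => m (x + s) - m x - α * s) volume 0 t :=
    (hI'.sub intervalIntegrable_const).sub (Continuous.intervalIntegrable (by fun_prop) _ _)
  have h1 : (∫ y in a..(x + t), m y) - (∫ y in a..x, m y) - t * m x
      = (∫ s in (0:ℝ)..t, (m (x + s) - m x - α * s)) + α * t ^ 2 / 2 := by
    rw [intervalIntegral.integral_interval_sub_left (hii _ ha _ hxt)
      (hii _ ha _ (Ioo_subset_Icc_self hx)), intervalIntegral.integral_sub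
      (hI'.sub intervalIntegrable_const) (Continuous.intervalIntegrable (by fun_prop) _ _),
      intervalIntegral.integral_sub hI' intervalIntegrable_const,
      intervalIntegral.integral_comp_add_left, intervalIntegral.integral_const_mul, integral_id]
    simp
    ring
  have hI3 : IntervalIntegrable (fun s => max (m (x + s) - m x - α * s) 0) volume 0 t := by
    rw [intervalIntegrable_iff] at hI2 ⊢
    exact hI2.pos_part
  have h2 := intervalIntegral.integral_mono ht0.1.le hI2 hI3 fun s => le_max_left _ _
  rw [h1]
  linarith

theorem MemLr.integrableOn {a b : ℝ} {m : ℝ → ℝ} (h : MemLr 1 a b m) :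
    IntegrableOn m (Icc a b) := by
  rw [MemLr, ENNReal.ofReal_one, memLp_one_iff_integrable] at h
  exact h

theorem IsMinorFunction.secondOrderMinor {a b : ℝ} {f m : ℝ → ℝ}
    (h : IsMinorFunction 1 a b f m) :
    SecondOrderMinor a b f m (fun y => ∫ t in a..y, m t) where
  deriv x hx := (h.continuousAt x hx).hasDerivWithinAt hx h.memLr.integrableOn
  ae_bound := by
    filter_upwards [ae_imp_of_ae_restrict h.derivate_le] with x hx hxab κ hκ
    have h1 : upperRightDerivate 1 m x ≤ f x := by
      have := hx (Ioo_subset_Icc_self hxab)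
      rw [upperDerivate, if_pos hxab.2] at this
      exact (le_max_left _ _).trans this
    obtain ⟨α, hα, H⟩ := exists_of_upperRightDerivate_lt
      (h1.trans_lt (EReal.coe_lt_coe_iff.2 (by linarith : f x < f x + κ)))
    have hα := EReal.coe_lt_coe_iff.1 hα
    exact (secondOrderBound_of_integral_le hxab h.memLr.integrableOn
      (H (κ / 2) (by linarith))).mono (by linarith)
  countable := by
    refine h.derivate_lt_top.mono ?_
    rintro x ⟨hx, hx'⟩
    refine ⟨Ioo_subset_Icc_self hx, fun hlt => hx' ?_⟩
    rw [upperDerivate, if_pos hx.2] at hlt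
    obtain ⟨α, -, H⟩ := exists_of_upperRightDerivate_lt ((le_max_left _ _).trans_lt hlt)
    exact ⟨_, secondOrderBound_of_integral_le hx h.memLr.integrableOn (H 1 one_pos)⟩

theorem Differentiable.secondOrderMinor {k : ℝ → ℝ} (hk : Differentiable ℝ k) (a b : ℝ) :
    SecondOrderMinor a b (deriv k) k (fun y => ∫ t in a..y, k t) := by
  have H : ∀ x ∈ Ioo a b, ∀ κ : ℝ, 0 < κ →
      SecondOrderBound (fun y => ∫ t in a..y, k t) k x (deriv k x / 2 + κ) := by
    intro x hx κ hκ
    -- With slope `deriv k x + 2 * κ` the positive part vanishes near `x`, hence the added constant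
    -- `0`.
    have h1 : SecondOrderBound (fun y => ∫ t in a..y, k t) k x ((deriv k x + 2 * κ) / 2 + 0) := by
      refine secondOrderBound_of_integral_le hx hk.continuous.continuousOn.integrableOn_Icc ?_
      have h2 := (isLittleO_iff.1 (hasDerivAt_iff_isLittleO_nhds_zero.1 (hk x).hasDerivAt))
        (show 0 < 2 * κ by linarith)
      obtain ⟨δ, hδ, hball⟩ := Metric.eventually_nhds_iff.1 h2
      filter_upwards [Ioo_mem_nhdsGT hδ] with t ht
      rw [zero_mul]
      refine (intervalIntegral.integral_congr (g := fun _ => 0) fun s hs => ?_).trans_le (by simp)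
      rw [uIcc_of_le ht.1.le] at hs
      have := hball (y := s) (by rw [Real.dist_eq, sub_zero, abs_of_nonneg hs.1]; linarith [hs.2, ht.2])
      rw [Real.norm_eq_abs, Real.norm_eq_abs, abs_of_nonneg hs.1] at this
      have := (le_abs_self _).trans this
      simp only [smul_eq_mul] at this
      exact max_eq_right (by linarith)
    exact h1.mono (by linarith)
  refine ⟨fun x _ => (hk.continuous.integral_hasStrictDerivAt a x).hasDerivAt.hasDerivWithinAt,
    ae_of_all _ H, ?_⟩
  convert countable_empty
  refine eq_empty_of_forall_notMem ?_
  rintro x ⟨hx, hx'⟩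
  exact hx' ⟨_, H x hx 1 one_pos⟩

/-! ### Sums of bumps and their `HK_r`-integrability -/

/-- Countably many pairwise disjoint open intervals `(z - ρ, z + ρ)`, each carrying a differentiable
bump `k` supported in the smaller interval `[z - w, z + w]`. -/
structure BumpFamily (ι : Type*) where
  z : ι → ℝ
  ρ : ι → ℝ
  w : ι → ℝ
  k : ι → ℝ → ℝ
  w_pos : ∀ s, 0 < w s
  w_le : ∀ s, w s ≤ ρ s / 2
  disjoint : ∀ s t, s ≠ t → Disjoint (Ioo (z s - ρ s) (z s + ρ s)) (Ioo (z t - ρ t) (z t + ρ t))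
  differentiable : ∀ s, Differentiable ℝ (k s)
  mem_Icc : ∀ s y, k s y ∈ Icc (0 : ℝ) 4
  eq_zero : ∀ s y, w s ≤ |y - z s| → k s y = 0

namespace BumpFamily

variable {ι : Type*} (B : BumpFamily ι)

/-- The open interval around the bump number `s`. -/
def gap (s : ι) : Set ℝ := Ioo (B.z s - B.ρ s) (B.z s + B.ρ s)

/-- The sum of all bumps. -/
noncomputable def sum (y : ℝ) : ℝ := ∑' s, B.k s y

open Classical in
/-- The derivative of the sum of the bumps in the gaps, extended by zero. -/
noncomputable def derivative (y : ℝ) : ℝ := if y ∈ ⋃ s, B.gap s then deriv B.sum y else 0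

theorem ρ_pos (s : ι) : 0 < B.ρ s := by linarith [B.w_pos s, B.w_le s]

theorem abs_lt_of_mem_gap {s : ι} {y : ℝ} : y ∈ B.gap s ↔ |y - B.z s| < B.ρ s := by
  rw [gap, mem_Ioo, abs_lt]
  constructor <;> rintro ⟨h1, h2⟩ <;> constructor <;> linarith

theorem k_eq_zero_of_notMem {s : ι} {y : ℝ} (hy : y ∉ B.gap s) : B.k s y = 0 := by
  rw [abs_lt_of_mem_gap, not_lt] at hy
  exact B.eq_zero s y (by linarith [B.w_pos s, B.w_le s])

theorem sum_of_mem {s : ι} {y : ℝ} (hy : y ∈ B.gap s) : B.sum y = B.k s y :=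
  tsum_eq_single s fun t hts => B.k_eq_zero_of_notMem fun ht =>
    disjoint_left.1 (B.disjoint t s hts) ht hy

theorem sum_of_notMem {y : ℝ} (hy : y ∉ ⋃ s, B.gap s) : B.sum y = 0 := by
  rw [mem_iUnion, not_exists] at hy
  rw [sum, tsum_congr fun s => B.k_eq_zero_of_notMem (hy s), tsum_zero]

theorem sum_mem_Icc (y : ℝ) : B.sum y ∈ Icc (0 : ℝ) 4 := by
  by_cases hy : y ∈ ⋃ s, B.gap s
  · obtain ⟨s, hs⟩ := mem_iUnion.1 hy
    rw [B.sum_of_mem hs]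
    exact B.mem_Icc s y
  · rw [B.sum_of_notMem hy]
    norm_num

theorem measurable_sum [Countable ι] : Measurable B.sum :=
  Measurable.tsum fun s => (B.differentiable s).continuous.measurable

theorem sum_eventuallyEq {s : ι} {y : ℝ} (hy : y ∈ B.gap s) : B.sum =ᶠ[𝓝 y] B.k s := by
  filter_upwards [isOpen_Ioo.mem_nhds hy] with t ht
  exact B.sum_of_mem ht

theorem derivative_of_mem {s : ι} {y : ℝ} (hy : y ∈ B.gap s) :
    B.derivative y = deriv (B.k s) y := by
  rw [derivative, if_pos (mem_iUnion.2 ⟨s, hy⟩), (B.sum_eventuallyEq hy).deriv_eq]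

theorem derivative_of_notMem {y : ℝ} (hy : y ∉ ⋃ s, B.gap s) : B.derivative y = 0 := by
  rw [derivative, if_neg hy]

theorem hasDerivAt_sum {y : ℝ} (hy : y ∈ ⋃ s, B.gap s) : HasDerivAt B.sum (B.derivative y) y := by
  obtain ⟨s, hs⟩ := mem_iUnion.1 hy
  rw [B.derivative_of_mem hs]
  exact (B.differentiable s y).hasDerivAt.congr_of_eventuallyEq (B.sum_eventuallyEq hs)

theorem memLr_sum [Countable ι] (r a b : ℝ) : MemLr r a b B.sum := by
  refine MemLp.of_bound B.measurable_sum.aestronglyMeasurable 4 (ae_of_all _ fun y => ?_)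
  rw [Real.norm_eq_abs, abs_of_nonneg (B.sum_mem_Icc y).1]
  exact (B.sum_mem_Icc y).2

/-- The bumps that the interval `[c, d]` meets. -/
def meets (c d : ℝ) : Set ι := {s | ∃ y ∈ Icc c d, |y - B.z s| < B.w s}

/-- Since `w ≤ ρ / 2`, a point outside the gap is separated from the bump by half the gap radius. -/
theorem half_ρ_lt_abs_sub {x y : ℝ} {s : ι} (hx : x ∉ ⋃ s, B.gap s)
    (hs : |y - B.z s| < B.w s) : B.ρ s / 2 < |y - x| := by
  rw [mem_iUnion, not_exists] at hx
  have h1 := hx s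
  rw [abs_lt_of_mem_gap, not_lt] at h1
  have h2 := abs_sub_le x y (B.z s)
  rw [abs_sub_comm x y] at h2
  linarith [B.w_le s]

end BumpFamily

theorem mean_rpow_le {r c d K : ℝ} (hr : 1 ≤ r) (hcd : c < d) (hK : 0 ≤ K) {g : ℝ → ℝ}
    (hg : ∀ y ∈ Icc c d, |g y| ≤ K) :
    (1 / (d - c) * ∫ y in c..d, |g y| ^ r) ^ (1 / r) ≤ K := by
  have hdc : 0 < d - c := sub_pos.2 hcd
  have h1 : ∫ y in c..d, |g y| ^ r ≤ K ^ r * (d - c) := by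
    have := intervalIntegral.norm_integral_le_of_norm_le_const (a := c) (b := d) (C := K ^ r)
      (f := fun y => |g y| ^ r) (fun y hy => by
        rw [uIoc_of_le hcd.le] at hy
        rw [Real.norm_eq_abs, abs_of_nonneg (by positivity)]
        exact Real.rpow_le_rpow (abs_nonneg _) (hg y (Ioc_subset_Icc_self hy)) (by linarith))
    rw [abs_of_pos hdc] at this
    exact (le_abs_self _).trans this
  have h0 : 0 ≤ ∫ y in c..d, |g y| ^ r :=
    intervalIntegral.integral_nonneg hcd.le fun _ _ => by positivity
  calc _ ≤ (K ^ r) ^ (1 / r) := by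
        refine Real.rpow_le_rpow (by positivity) ?_ (by positivity)
        rw [one_div, inv_mul_le_iff₀ hdc]
        linarith
    _ = K := by rw [← Real.rpow_mul hK, mul_one_div_cancel (by linarith), Real.rpow_one]

namespace BumpFamily

variable {ι : Type*} (B : BumpFamily ι)

/-- Each bump met has `ρ / 2 < d - c`, so the width condition bounds the measure of its support by
`(d - c) * 4 ^ (-r) * b s ^ r`. Since `b s ≤ β`, one has `b s ^ r ≤ b s * β ^ (r - 1)`, and
summation gives `β ^ r` for the mean. -/
theorem mean_sum_rpow_le [Countable ι] {r : ℝ} (hr : 1 ≤ r) {b : ι → ℝ} (hb0 : ∀ s, 0 ≤ b s)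
    (hb : Summable b) (hw : ∀ s, 4 ^ r * (4 * B.w s / B.ρ s) ≤ b s ^ r) {c d x : ℝ} (hcd : c < d)
    (hx : x ∈ Icc c d) (hxB : x ∉ ⋃ s, B.gap s) :
    (1 / (d - c) * ∫ y in c..d, |B.sum y| ^ r) ^ (1 / r) ≤
      ∑' s, (B.meets c d).indicator b s := by
  classical
  have hdc : 0 < d - c := sub_pos.2 hcd
  set b' := (B.meets c d).indicator b with hb'
  have hb'0 : ∀ s, 0 ≤ b' s := fun s => indicator_nonneg (fun s _ => hb0 s) s
  have hb's : Summable b' := hb.indicator _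
  set β := ∑' s, b' s with hβ
  have hβ0 : 0 ≤ β := tsum_nonneg hb'0
  let V : ι → Set ℝ := fun s =>
    if s ∈ B.meets c d then Icc (B.z s - B.w s) (B.z s + B.w s) else ∅
  let e : ℝ := (d - c) * (4 ^ r)⁻¹ * β ^ (r - 1)
  have he : 0 ≤ e := by positivity
  have hV : ∀ s, volume (V s) ≤ ENNReal.ofReal (e * b' s) := by
    intro s
    by_cases hs : s ∈ B.meets c d
    · obtain ⟨y, hy, hys⟩ := id hs
      have h1 := B.half_ρ_lt_abs_sub hxB hys
      have h2 : |y - x| ≤ d - c := abs_sub_le_of_le_of_le hy.1 hy.2 hx.1 hx.2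
      have h3 : b' s = b s := indicator_of_mem hs b
      have h4 : b s ^ r ≤ b s * β ^ (r - 1) := by
        rcases (hb0 s).eq_or_lt with h0 | h0
        · rw [← h0, Real.zero_rpow (by linarith), zero_mul]
        · rw [show b s ^ r = b s * b s ^ (r - 1) by
            rw [← Real.rpow_one_add' h0.le (by linarith)]; congr 1; ring]
          refine mul_le_mul_of_nonneg_left (Real.rpow_le_rpow h0.le ?_ (by linarith)) h0.le
          rw [← h3]
          exact hb's.le_tsum s fun t _ => hb'0 t
      simp only [V, if_pos hs]
      rw [Real.volume_Icc]
      refine ENNReal.ofReal_le_ofReal ?_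
      rw [h3]
      have h5 := (hw s).trans h4
      have hρ := B.ρ_pos s
      have h4r : (0 : ℝ) < 4 ^ r := by positivity
      have h6 : 4 * B.w s / B.ρ s ≤ (4 ^ r)⁻¹ * (b s * β ^ (r - 1)) := by
        rw [le_inv_mul_iff₀ h4r]
        exact h5
      rw [div_le_iff₀ hρ] at h6
      have h7 : 0 ≤ (4 ^ r)⁻¹ * (b s * β ^ (r - 1)) := by
        have := hb0 s
        positivity
      have h8 : (4 ^ r)⁻¹ * (b s * β ^ (r - 1)) * B.ρ s ≤
        (4 ^ r)⁻¹ * (b s * β ^ (r - 1)) * (2 * (d - c)) :=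
        mul_le_mul_of_nonneg_left (by linarith) h7
      simp only [e]
      linarith
    · simp [V, hs]
  have hU : volume (⋃ s, V s) ≤ ENNReal.ofReal (e * β) := by
    refine (measure_iUnion_le _).trans ((ENNReal.tsum_le_tsum hV).trans_eq ?_)
    rw [← ENNReal.ofReal_tsum_of_nonneg (fun s => mul_nonneg he (hb'0 s)) (hb's.mul_left e),
      tsum_mul_left]
  have hUm : MeasurableSet (⋃ s, V s) := by
    refine MeasurableSet.iUnion fun s => ?_
    by_cases hs : s ∈ B.meets c d <;> simp [V, hs]
  have hUr : volume.real (⋃ s, V s) ≤ e * β :=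
    ENNReal.toReal_le_of_le_ofReal (mul_nonneg he hβ0) hU
  have hint : ∫ y in c..d, |B.sum y| ^ r ≤ 4 ^ r * (e * β) := by
    have hle : ∀ y ∈ Ioc c d, |B.sum y| ^ r ≤ (⋃ s, V s).indicator (fun _ => (4 : ℝ) ^ r) y := by
      intro y hy
      by_cases h0 : B.sum y = 0
      · rw [h0, abs_zero, Real.zero_rpow (by linarith)]
        exact indicator_nonneg (fun _ _ => by positivity) y
      · have hyB : y ∈ ⋃ s, B.gap s := by
          by_contra hc
          exact h0 (B.sum_of_notMem hc)
        obtain ⟨s, hs⟩ := mem_iUnion.1 hyB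
        have hys : |y - B.z s| < B.w s := by
          by_contra! hc
          exact h0 (by rw [B.sum_of_mem hs, B.eq_zero s y hc])
        have hsm : s ∈ B.meets c d := ⟨y, Ioc_subset_Icc_self hy, hys⟩
        have hyV : y ∈ ⋃ s, V s := by
          refine mem_iUnion.2 ⟨s, ?_⟩
          simp only [V, if_pos hsm]
          rw [abs_lt] at hys
          constructor <;> linarith
        rw [indicator_of_mem hyV, abs_of_nonneg (B.sum_mem_Icc y).1]
        exact Real.rpow_le_rpow (B.sum_mem_Icc y).1 (B.sum_mem_Icc y).2 (by linarith)
    have hUi : Integrable ((⋃ s, V s).indicator (fun _ => (4 : ℝ) ^ r)) :=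
      (integrable_indicator_iff hUm).2
        (integrableOn_const (hU.trans_lt ENNReal.ofReal_lt_top).ne)
    rw [intervalIntegral.integral_of_le hcd.le]
    calc _ ≤ ∫ y in Ioc c d, (⋃ s, V s).indicator (fun _ => (4 : ℝ) ^ r) y := by
          refine integral_mono_of_nonneg (ae_of_all _ fun _ => by positivity) hUi.integrableOn ?_
          filter_upwards [ae_restrict_mem measurableSet_Ioc] with y hy using hle y hy
      _ ≤ ∫ y, (⋃ s, V s).indicator (fun _ => (4 : ℝ) ^ r) y :=
          setIntegral_le_integral hUi
            (ae_of_all _ fun y => indicator_nonneg (fun _ _ => by positivity) y)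
      _ ≤ _ := by
          rw [integral_indicator_const _ hUm, smul_eq_mul, mul_comm]
          exact mul_le_mul_of_nonneg_left hUr (by positivity)
  have hint0 : 0 ≤ ∫ y in c..d, |B.sum y| ^ r :=
    intervalIntegral.integral_nonneg hcd.le fun _ _ => by positivity
  calc _ ≤ (β ^ r) ^ (1 / r) := by
        refine Real.rpow_le_rpow (by positivity) ?_ (by positivity)
        rw [one_div, inv_mul_le_iff₀ hdc]
        refine hint.trans_eq ?_
        have h1 : β ^ r = β ^ (r - 1) * β := by
          rw [← Real.rpow_add_one' hβ0 (by linarith)]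
          congr 1
          ring
        rw [h1]
        simp only [e]
        have : (4 : ℝ) ^ r ≠ 0 := by positivity
        field_simp
    _ = β := by rw [← Real.rpow_mul hβ0, mul_one_div_cancel (by linarith), Real.rpow_one]

end BumpFamily

theorem IsFineCollection.sum_length_le {a b : ℝ} (hab : a ≤ b) {δ : ℝ → ℝ} {n : ℕ}
    {c d x : Fin n → ℝ} (h : IsFineCollection a b δ c d x) (P : Finset (Fin n)) :
    ∑ i ∈ P, (d i - c i) ≤ b - a := by
  have h1 : volume.real (⋃ i ∈ P, Ioo (c i) (d i)) = ∑ i ∈ P, (d i - c i) := by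
    rw [measureReal_biUnion_finset (fun i _ j _ hij => h.nonoverlapping i j hij)
      (fun _ _ => measurableSet_Ioo) (fun _ _ => measure_Ioo_lt_top.ne)]
    exact Finset.sum_congr rfl fun i _ => Real.volume_real_Ioo_of_le (h.lt i).le
  rw [← h1, ← Real.volume_real_Icc_of_le hab]
  exact measureReal_mono (iUnion₂_subset fun i _ => Ioo_subset_Icc_self.trans (h.subset i))
    measure_Icc_lt_top.ne

theorem IsFineCollection.card_filter_mem_le {a b : ℝ} {δ : ℝ → ℝ} {n : ℕ} {c d x : Fin n → ℝ}
    (h : IsFineCollection a b δ c d x) (y : ℝ) [DecidablePred fun i => y ∈ Ioo (c i) (d i)] :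
    (Finset.univ.filter fun i => y ∈ Ioo (c i) (d i)).card ≤ 1 := by
  refine Finset.card_le_one.2 fun i hi j hj => ?_
  by_contra hij
  simp only [Finset.mem_filter, Finset.mem_univ, true_and] at hi hj
  exact disjoint_left.1 (h.nonoverlapping i j hij) hi hj

namespace BumpFamily

variable {ι : Type*} (B : BumpFamily ι)

/-- The points at distance `3 / 4 * ρ` lie strictly between the bump and the ends of its gap. An
interval going from outside to the bump crosses one of them, and nonoverlapping intervals cannot
share it in their interiors. -/
theorem mem_Ioo_of_mem_meets {c d x : ℝ} {s : ι} (hx : x ∈ Icc c d) (hxB : x ∉ ⋃ s, B.gap s)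
    (hs : s ∈ B.meets c d) :
    B.z s - 3 / 4 * B.ρ s ∈ Ioo c d ∨ B.z s + 3 / 4 * B.ρ s ∈ Ioo c d := by
  obtain ⟨y, hy, hys⟩ := hs
  rw [mem_iUnion, not_exists] at hxB
  have h1 := hxB s
  rw [abs_lt_of_mem_gap, not_lt, le_abs] at h1
  have hw := B.w_le s
  have hρ := B.ρ_pos s
  rw [abs_lt] at hys
  rcases h1 with h1 | h1
  · exact Or.inr ⟨by linarith [hy.1], by linarith [hx.2]⟩
  · exact Or.inl ⟨by linarith [hx.1], by linarith [hy.2]⟩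

theorem sum_indicator_meets_le {a b : ℝ} {δ : ℝ → ℝ} {n : ℕ} {c d x : Fin n → ℝ}
    (h : IsFineCollection a b δ c d x) {P : Finset (Fin n)} (hP : ∀ i ∈ P, x i ∉ ⋃ s, B.gap s)
    {b : ι → ℝ} {s : ι} (hb : 0 ≤ b s) :
    ∑ i ∈ P, (B.meets (c i) (d i)).indicator b s ≤ 2 * b s := by
  classical
  have h1 : ∑ i ∈ P, (B.meets (c i) (d i)).indicator b s =
      (P.filter fun i => s ∈ B.meets (c i) (d i)).card * b s := by
    rw [← nsmul_eq_mul, ← Finset.sum_const, Finset.sum_filter]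
    rfl
  rw [h1]
  refine mul_le_mul_of_nonneg_right ?_ hb
  have h2 : (P.filter fun i => s ∈ B.meets (c i) (d i)) ⊆
      (Finset.univ.filter fun i => B.z s - 3 / 4 * B.ρ s ∈ Ioo (c i) (d i)) ∪
      (Finset.univ.filter fun i => B.z s + 3 / 4 * B.ρ s ∈ Ioo (c i) (d i)) := by
    intro i hi
    rw [Finset.mem_filter] at hi
    simp only [Finset.mem_union, Finset.mem_filter, Finset.mem_univ, true_and]
    exact B.mem_Ioo_of_mem_meets (h.tag_mem i) (hP i hi.1) hi.2
  have h3 := (Finset.card_le_card h2).trans (Finset.card_union_le _ _)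
  have h4 := h.card_filter_mem_le (B.z s - 3 / 4 * B.ρ s)
  have h5 := h.card_filter_mem_le (B.z s + 3 / 4 * B.ρ s)
  exact_mod_cast h3.trans (add_le_add h4 h5)

/-- Tags outside the gaps get a constant gauge, so small that the intervals miss the bumps of a large
finite set; each remaining bump is met by at most two of the intervals with such tags. -/
theorem isHKrPrimitive_sum [Countable ι] {r : ℝ} (hr : 1 ≤ r) {b : ι → ℝ} (hb0 : ∀ s, 0 ≤ b s)
    (hb : Summable b) (hw : ∀ s, 4 ^ r * (4 * B.w s / B.ρ s) ≤ b s ^ r) :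
    IsHKrPrimitive r 0 1 B.derivative B.sum := by
  classical
  refine ⟨B.memLr_sum r 0 1, fun ε hε => ?_⟩
  have hgauge : ∀ x, ∃ δ > 0, x ∈ ⋃ s, B.gap s → ∀ y, |y - x| < δ →
      |B.sum y - B.sum x - B.derivative x * (y - x)| ≤ ε / 4 * |y - x| := by
    intro x
    by_cases hx : x ∈ ⋃ s, B.gap s
    · have h1 := isLittleO_iff.1 (hasDerivAt_iff_isLittleO.1 (B.hasDerivAt_sum hx))
        (show 0 < ε / 4 by linarith)
      obtain ⟨δ, hδ, H⟩ := Metric.eventually_nhds_iff.1 h1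
      refine ⟨δ, hδ, fun _ y hy => ?_⟩
      have := H (y := y) (by rwa [Real.dist_eq])
      rwa [Real.norm_eq_abs, Real.norm_eq_abs, smul_eq_mul, mul_comm (y - x)] at this
    · exact ⟨1, one_pos, fun h => absurd h hx⟩
  choose δ₁ hδ₁ hδ₁' using hgauge
  -- The tail is below `ε / 8` because each bump is counted up to twice.
  obtain ⟨T, hT⟩ : ∃ T : Finset ι, ∑' s, {s | s ∉ T}.indicator b s < ε / 8 := by
    have h1 := (tendsto_tsum_compl_atTop_zero b).eventually
      (gt_mem_nhds (show 0 < ε / 8 by linarith))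
    obtain ⟨T, hT⟩ := h1.exists
    refine ⟨T, ?_⟩
    rwa [← tsum_subtype]
  obtain ⟨δ₀, hδ₀, hδ₀T⟩ : ∃ δ₀ > 0, ∀ s ∈ T, δ₀ ≤ B.ρ s / 2 := by
    have h1 : ∀ᶠ δ in 𝓝[>] (0 : ℝ), ∀ s ∈ T, δ ≤ B.ρ s / 2 :=
      (T.eventually_all).2 fun s _ => by
        filter_upwards [Ioo_mem_nhdsGT (half_pos (B.ρ_pos s))] with t ht using ht.2.le
    obtain ⟨t, ht, ht0⟩ := (h1.and self_mem_nhdsWithin).exists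
    exact ⟨t, ht0, ht⟩
  refine ⟨fun x => if x ∈ ⋃ s, B.gap s then δ₁ x else δ₀, fun x _ => ?_, fun n c d x h => ?_⟩
  · dsimp only
    split_ifs
    exacts [hδ₁ x, hδ₀]
  have hfine : ∀ i, ∀ y ∈ Icc (c i) (d i),
      |y - x i| < if x i ∈ ⋃ s, B.gap s then δ₁ (x i) else δ₀ := fun i y hy => by
    have := h.fine i hy
    rw [abs_lt]
    constructor <;> linarith [this.1, this.2]
  have hlen : ∀ i, ∀ y ∈ Icc (c i) (d i), |y - x i| ≤ d i - c i := fun i y hy =>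
    abs_sub_le_of_le_of_le hy.1 hy.2 (h.tag_mem i).1 (h.tag_mem i).2
  rw [← Finset.sum_filter_add_sum_filter_not Finset.univ fun i => x i ∈ ⋃ s, B.gap s]
  have hin : ∑ i with x i ∈ ⋃ s, B.gap s, (1 / (d i - c i) * ∫ y in (c i)..(d i),
      |B.sum y - B.sum (x i) - B.derivative (x i) * (y - x i)| ^ r) ^ (1 / r) ≤ ε / 4 := by
    calc _ ≤ ∑ i with x i ∈ ⋃ s, B.gap s, ε / 4 * (d i - c i) := by
          refine Finset.sum_le_sum fun i hi => ?_
          have hi := (Finset.mem_filter.1 hi).2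
          refine mean_rpow_le hr (h.lt i)
            (mul_nonneg (by linarith) (sub_nonneg.2 (h.lt i).le)) fun y hy => ?_
          have h1 := hfine i y hy
          rw [if_pos hi] at h1
          exact (hδ₁' _ hi y h1).trans (mul_le_mul_of_nonneg_left (hlen i y hy) (by linarith))
      _ ≤ ε / 4 := by
          rw [← Finset.mul_sum]
          have := h.sum_length_le zero_le_one (Finset.univ.filter fun i => x i ∈ ⋃ s, B.gap s)
          nlinarith
  have hout : ∑ i with x i ∉ ⋃ s, B.gap s, (1 / (d i - c i) * ∫ y in (c i)..(d i),
      |B.sum y - B.sum (x i) - B.derivative (x i) * (y - x i)| ^ r) ^ (1 / r) ≤ ε / 4 := by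
    calc _ ≤ ∑ i with x i ∉ ⋃ s, B.gap s, ∑' s, (B.meets (c i) (d i)).indicator b s := by
          refine Finset.sum_le_sum fun i hi => ?_
          have hi := (Finset.mem_filter.1 hi).2
          rw [B.sum_of_notMem hi, B.derivative_of_notMem hi]
          simp only [zero_mul, sub_zero]
          exact B.mean_sum_rpow_le hr hb0 hb hw (h.lt i) (h.tag_mem i) hi
      _ = ∑' s, ∑ i with x i ∉ ⋃ s, B.gap s, (B.meets (c i) (d i)).indicator b s :=
          (Summable.tsum_finsetSum fun i _ => hb.indicator _).symm
      _ ≤ ∑' s, 2 * {s | s ∉ T}.indicator b s := by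
          refine Summable.tsum_le_tsum (fun s => ?_)
            (summable_sum fun i _ => hb.indicator _) ((hb.indicator _).mul_left 2)
          by_cases hs : s ∈ T
          · rw [indicator_of_notMem (by simpa using hs), mul_zero]
            refine (Finset.sum_eq_zero fun i hi => indicator_of_notMem ?_ _).le
            rintro ⟨y, hy, hys⟩
            have hi := (Finset.mem_filter.1 hi).2
            have h1 := hfine i y hy
            rw [if_neg hi] at h1
            linarith [B.half_ρ_lt_abs_sub hi hys, hδ₀T s hs]
          · rw [indicator_of_mem (by simpa using hs)]
            exact B.sum_indicator_meets_le h (fun i hi => (Finset.mem_filter.1 hi).2) (hb0 s)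
      _ ≤ ε / 4 := by
          rw [tsum_mul_left]
          linarith
  linarith

end BumpFamily

/-! ### Major and minor functions that are close together -/

/-- Both `M - m` on `[0, 1]` and `M - B.k s` in the gap are nondecreasing: the corresponding sums of
point functions vanish. The first has total increment below 1, so `m` must follow the rise of `M`.
-/
theorem BumpFamily.sub_le_of_major_minor {ι : Type*} {B : BumpFamily ι} {M m : ℝ → ℝ}
    (hM : IsMajorFunction 1 0 1 B.derivative M) (hm : IsMinorFunction 1 0 1 B.derivative m)
    (hMm : M 1 - m 1 < 1) {s : ι} (hs : B.gap s ⊆ Icc 0 1) {u v : ℝ} (hu : u ∈ B.gap s)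
    (hv : v ∈ B.gap s) (huv : u < v) : B.k s v - B.k s u - 1 ≤ m v - m u := by
  have hM' := hM.secondOrderMinor
  have hm' := hm.secondOrderMinor
  have hanti : ∀ y ∈ Icc (0 : ℝ) 1, ∀ y' ∈ Icc (0 : ℝ) 1, y < y' →
      m y' + -M y' ≤ m y + -M y := fun y hy y' hy' hlt =>
    ((hm'.add hM').mono hy.1 hy'.2).le hlt fun x _ => by ring
  have hle : ∀ y ∈ Icc (0 : ℝ) 1, ∀ y' ∈ Icc (0 : ℝ) 1, y ≤ y' →
      m y' + -M y' ≤ m y + -M y := fun y hy y' hy' hlt => by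
    rcases hlt.eq_or_lt with rfl | hlt
    · exact le_rfl
    · exact hanti y hy y' hy' hlt
  have h0 := hle 0 ⟨le_rfl, zero_le_one⟩ u (hs hu) (hs hu).1
  have h1 := hle v (hs hv) 1 ⟨zero_le_one, le_rfl⟩ (hs hv).2
  have h2 : -M v + B.k s v ≤ -M u + B.k s u := by
    refine ((hM'.mono (hs hu).1 (hs hv).2).add
      (Differentiable.secondOrderMinor (B.differentiable s) u v)).le huv fun x hx => ?_
    have hxs : x ∈ B.gap s := ⟨hu.1.trans hx.1, hx.2.trans hv.2⟩
    rw [B.derivative_of_mem hxs]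
    ring
  have hm0 := hm.map_left
  have hM0 : -M 0 = 0 := hM.map_left
  linarith

/-- If the minor function `m` has a finite upper derivate at `x`, then the small gaps near `x` carry
narrow bumps. -/
theorem BumpFamily.exists_forall_w_le {ι : Type*} {B : BumpFamily ι} {M m : ℝ → ℝ}
    (hM : IsMajorFunction 1 0 1 B.derivative M) (hm : IsMinorFunction 1 0 1 B.derivative m)
    (hMm : M 1 - m 1 < 1) {x : ℝ} (hx : x ∈ Ico (0 : ℝ) 1) (hxm : upperDerivate 1 0 1 m x < ⊤) :
    ∃ δ > 0, ∀ s, B.gap s ⊆ Icc 0 1 → (∀ y, |y - B.z s| ≤ B.w s / 2 → B.k s y = 4) →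
      x < B.z s - B.ρ s → B.z s + B.ρ s - x ≤ 4 * B.ρ s → 4 * B.ρ s < δ →
      B.w s ≤ 16 * B.ρ s ^ 2 := by
  rw [upperDerivate, if_pos hx.2] at hxm
  obtain ⟨α, -, hα⟩ := exists_of_upperRightDerivate_lt ((le_max_left _ _).trans_lt hxm)
  obtain ⟨δ₁, hδ₁, H₁⟩ := mem_nhdsGT_iff_exists_Ioo_subset.1 (hα 1 one_pos)
  -- At radius `4 * ρ` this bounds the integral by `ρ / 8`, while `|m y - m x| > 1` on the stretch
  -- of length `ρ / 4` chosen below would make it at least `ρ / 4`.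
  obtain ⟨δ₂, hδ₂, H₂⟩ := (hm.continuousAt x (Ico_subset_Icc_self hx)).eventually_integral_le
    (show (0 : ℝ) < 1 / 32 by norm_num)
  have hα0 : 0 < 1 / (|α| + 1) := by positivity
  refine ⟨min (min δ₁ δ₂) (min (1 - x) (1 / (|α| + 1))),
    lt_min (lt_min hδ₁ hδ₂) (lt_min (sub_pos.2 hx.2) hα0), ?_⟩
  intro s hs hk hxs hsx hδ
  rw [lt_min_iff, lt_min_iff, lt_min_iff] at hδ
  obtain ⟨⟨hd1, hd2⟩, hd3, hd4⟩ := hδ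
  have hρ := B.ρ_pos s
  have hw := B.w_pos s
  have hw' := B.w_le s
  have hI := hm.memLr.integrableOn
  have hJ : IntervalIntegrable m volume x (x + 4 * B.ρ s) := by
    refine (hI.mono_set ?_).intervalIntegrable
    rw [uIcc_of_le (by linarith)]
    exact Icc_subset_Icc hx.1 (by linarith)
  obtain ⟨y, hy, hym⟩ : ∃ y ∈ Icc (B.z s - 3 / 4 * B.ρ s) (B.z s - B.ρ s / 2),
      |m y - m x| ≤ 1 := by
    by_contra! hc
    have h1 := H₂ (4 * B.ρ s) (by linarith) hd2
    have hsub : Icc (B.z s - 3 / 4 * B.ρ s) (B.z s - B.ρ s / 2) ⊆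
        Icc (x - 4 * B.ρ s) (x + 4 * B.ρ s) ∩ Icc 0 1 := by
      intro y hy
      refine ⟨⟨?_, ?_⟩, ?_, ?_⟩ <;> linarith [hy.1, hy.2, hx.1]
    have hint : IntegrableOn (fun y => |m y - m x|)
        (Icc (x - 4 * B.ρ s) (x + 4 * B.ρ s) ∩ Icc 0 1) :=
      ((hI.mono_set inter_subset_right).sub (integrableOn_const
        (measure_lt_top_mono inter_subset_right measure_Icc_lt_top).ne)).abs
    have h2 : ∫ y in Icc (B.z s - 3 / 4 * B.ρ s) (B.z s - B.ρ s / 2), |m y - m x| ≤ _ :=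
      setIntegral_mono_set hint (ae_of_all _ fun _ => abs_nonneg _) hsub.eventuallyLE
    have h3 : ∫ y in Icc (B.z s - 3 / 4 * B.ρ s) (B.z s - B.ρ s / 2), (1 : ℝ) ≤
        ∫ y in Icc (B.z s - 3 / 4 * B.ρ s) (B.z s - B.ρ s / 2), |m y - m x| :=
      setIntegral_mono_on (integrableOn_const measure_Icc_lt_top.ne) (hint.mono_set hsub)
        measurableSet_Icc fun y hy => (hc y hy).le
    rw [setIntegral_const, smul_eq_mul, mul_one, Real.volume_real_Icc_of_le (by linarith)] at h3
    linarith
  have hyw : B.k s y = 0 := B.eq_zero s y (by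
    rw [le_abs]
    right
    linarith [hy.2])
  -- The height 4 pays for the error in following the bump, for `|m y - m x|` and for `α * t`, each
  -- at most 1, and leaves 1 on a plateau of length `w`.
  have hbump : ∀ t ∈ Icc (B.z s - B.w s / 2 - x) (B.z s + B.w s / 2 - x),
      1 ≤ max (m (x + t) - m x - α * t) 0 := by
    intro t ht
    refine le_max_of_le_left ?_
    have h1 := BumpFamily.sub_le_of_major_minor hM hm hMm hs (u := y) (v := x + t)
      ⟨by linarith [hy.1], by linarith [hy.2]⟩ ⟨by linarith [ht.1], by linarith [ht.2]⟩
      (by linarith [hy.2, ht.1])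
    rw [hyw, hk (x + t) (by rw [abs_le]; constructor <;> linarith [ht.1, ht.2])] at h1
    have h2 : α * t ≤ 1 := by
      have ht0 : 0 ≤ t := by linarith [ht.1]
      have ht1 : t ≤ 1 / (|α| + 1) := by linarith [ht.2]
      rw [le_div_iff₀ (by positivity)] at ht1
      nlinarith [le_abs_self α]
    linarith [(abs_le.1 hym).1]
  have hmax : IntervalIntegrable (fun t => max (m (x + t) - m x - α * t) 0) volume 0
      (4 * B.ρ s) := by
    have h1 : IntervalIntegrable (fun t => m (x + t)) volume 0 (4 * B.ρ s) := by
      simpa using hJ.comp_add_left x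
    have h2 : IntervalIntegrable (fun t => m (x + t) - m x - α * t) volume 0 (4 * B.ρ s) :=
      (h1.sub intervalIntegrable_const).sub (Continuous.intervalIntegrable (by fun_prop) _ _)
    rw [intervalIntegrable_iff] at h2 ⊢
    exact h2.pos_part
  have h1 : ∫ t in (0 : ℝ)..(4 * B.ρ s), max (m (x + t) - m x - α * t) 0 ≤
      1 * (4 * B.ρ s) ^ 2 := H₁ ⟨by linarith, hd1⟩
  have h2 : ∫ t in (B.z s - B.w s / 2 - x)..(B.z s + B.w s / 2 - x),
      max (m (x + t) - m x - α * t) 0 ≤ ∫ t in (0 : ℝ)..(4 * B.ρ s),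
      max (m (x + t) - m x - α * t) 0 :=
    intervalIntegral.integral_mono_interval (by linarith) (by linarith) (by linarith)
      (ae_of_all _ fun _ => le_max_right _ _) hmax
  have h3 : ∫ t in (B.z s - B.w s / 2 - x)..(B.z s + B.w s / 2 - x), (1 : ℝ) ≤
      ∫ t in (B.z s - B.w s / 2 - x)..(B.z s + B.w s / 2 - x),
      max (m (x + t) - m x - α * t) 0 := by
    refine intervalIntegral.integral_mono_on (by linarith) intervalIntegrable_const
      (hmax.mono_set ?_) hbump
    rw [uIcc_of_le (by linarith), uIcc_of_le (by linarith)]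
    exact Icc_subset_Icc (by linarith) (by linarith)
  rw [intervalIntegral.integral_const, smul_eq_mul, mul_one] at h3
  linarith

/-! ### Gaps beside a self-similar Cantor set -/

/-- The centre of the gap attached to a finite word in the self-similar Cantor set generated by the
maps `y ↦ q * y` and `y ↦ q * y + 1 / 4`. -/
noncomputable def wordCenter (q : ℝ) : List Bool → ℝ
  | [] => 3 / 4
  | e :: s => cond e (1 / 4) 0 + q * wordCenter q s

theorem wordCenter_mem {q : ℝ} (hq0 : 0 < q) (hq : q ≤ 1 / 16) (s : List Bool) :
    0 ≤ wordCenter q s - q ^ s.length / 4 ∧ wordCenter q s + q ^ s.length / 4 ≤ 1 := by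
  induction s with
  | nil => norm_num [wordCenter]
  | cons e s ih =>
    rw [wordCenter, List.length_cons, pow_succ]
    have h1 := mul_le_mul_of_nonneg_left ih.2 hq0.le
    have h2 := mul_nonneg hq0.le ih.1
    cases e <;> constructor <;> simp only [cond] <;> linarith

/-- The gap of the empty word is `(1 / 2, 1)`, to the right of both first-level images of `[0, 1]`,
which are disjoint. Words with a common first letter reduce to their tails by scaling. -/
theorem wordCenter_separated {q : ℝ} (hq0 : 0 < q) (hq : q ≤ 1 / 16) (s t : List Bool)
    (hst : s ≠ t) :
    wordCenter q s + q ^ s.length / 4 ≤ wordCenter q t - q ^ t.length / 4 ∨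
      wordCenter q t + q ^ t.length / 4 ≤ wordCenter q s - q ^ s.length / 4 := by
  have hcons : ∀ e s, wordCenter q (e :: s) + q ^ (e :: s).length / 4 ≤ cond e (1 / 4) 0 + q ∧
      cond e (1 / 4) 0 ≤ wordCenter q (e :: s) - q ^ (e :: s).length / 4 := by
    intro e s
    obtain ⟨h1, h2⟩ := wordCenter_mem hq0 hq s
    rw [wordCenter, List.length_cons, pow_succ]
    have h3 := mul_le_mul_of_nonneg_left h2 hq0.le
    have h4 := mul_nonneg hq0.le h1
    constructor <;> linarith
  induction s generalizing t with
  | nil =>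
    cases t with
    | nil => exact absurd rfl hst
    | cons e t =>
      right
      refine (hcons e t).1.trans ?_
      cases e <;> simp only [cond, wordCenter, List.length_nil, pow_zero] <;> linarith
  | cons e s ih =>
    cases t with
    | nil =>
      left
      refine (hcons e s).1.trans ?_
      cases e <;> simp only [cond, wordCenter, List.length_nil, pow_zero] <;> linarith
    | cons e' t =>
      by_cases hee : e = e'
      · subst hee
        have hst' : s ≠ t := fun h => hst (by rw [h])
        simp only [wordCenter, List.length_cons, pow_succ]
        rcases ih t hst' with h | h
        · left
          have := mul_le_mul_of_nonneg_left h hq0.le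
          linarith
        · right
          have := mul_le_mul_of_nonneg_left h hq0.le
          linarith
      · have h1 := hcons e s
        have h2 := hcons e' t
        cases e <;> cases e' <;> simp only [cond] at h1 h2 <;>
          first | exact absurd rfl hee | (left; linarith) | (right; linarith)

/-- The first `n` letters of an infinite word. -/
def wordPrefix : (ℕ → Bool) → ℕ → List Bool
  | _, 0 => []
  | f, n + 1 => f 0 :: wordPrefix (fun i => f (i + 1)) n

theorem length_wordPrefix (f : ℕ → Bool) (n : ℕ) : (wordPrefix f n).length = n := by
  induction n generalizing f with
  | zero => rfl
  | succ n ih => rw [wordPrefix, List.length_cons, ih]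

theorem cantorFunction_nonneg {q : ℝ} (hq0 : 0 < q) (f : ℕ → Bool) :
    0 ≤ Cardinal.cantorFunction q f :=
  tsum_nonneg fun _ => Cardinal.cantorFunctionAux_nonneg hq0.le

theorem cantorFunction_lt_two {q : ℝ} (hq0 : 0 < q) (hq : q ≤ 1 / 16) (f : ℕ → Bool) :
    Cardinal.cantorFunction q f < 2 := by
  have h1 := Cardinal.cantorFunction_le hq0.le (by linarith) (f := f) (g := fun _ => true)
    fun _ _ => rfl
  have h2 : Cardinal.cantorFunction q (fun _ => true) = (1 - q)⁻¹ := by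
    rw [← tsum_geometric_of_lt_one hq0.le (by linarith)]
    rfl
  rw [h2] at h1
  refine h1.trans_lt ?_
  rw [inv_lt_comm₀ (by linarith) (by norm_num)]
  linarith

/-- By self-similarity it suffices to treat `n = 0`, where the Cantor point lies in `[0, 1 / 2)` and
the gap is `(1 / 2, 1)`. Every gap used lies to the right, so right derivates alone suffice. -/
theorem cantorFunction_near_gap {q : ℝ} (hq0 : 0 < q) (hq : q ≤ 1 / 16) (f : ℕ → Bool) (n : ℕ) :
    Cardinal.cantorFunction q f / 4 < wordCenter q (wordPrefix f n) - q ^ n / 4 ∧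
      wordCenter q (wordPrefix f n) + q ^ n / 4 - Cardinal.cantorFunction q f / 4 ≤ q ^ n := by
  induction n generalizing f with
  | zero =>
    have h1 := cantorFunction_nonneg hq0 f
    have h2 := cantorFunction_lt_two hq0 hq f
    simp only [wordPrefix, wordCenter, pow_zero]
    constructor <;> linarith
  | succ n ih =>
    obtain ⟨h1, h2⟩ := ih fun i => f (i + 1)
    rw [Cardinal.cantorFunction_succ f hq0.le (by linarith), wordPrefix, wordCenter, pow_succ]
    have h3 := mul_lt_mul_of_pos_left h1 hq0
    have h4 := mul_le_mul_of_nonneg_left h2 hq0.le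
    cases f 0 <;> simp only [cond] <;> constructor <;> linarith

theorem summable_pow_length : Summable fun s : List Bool => 8 * (1 / 4 : ℝ) ^ s.length := by
  refine Summable.mul_left 8 ?_
  rw [← (Equiv.sigmaFiberEquiv (List.length (α := Bool))).summable_iff]
  have hlen : ∀ n, ∀ v : {s : List Bool // s.length = n},
      (1 / 4 : ℝ) ^ (v : List Bool).length = (1 / 4) ^ n := fun n v => by rw [v.2]
  have hfin : ∀ n, Fintype {s : List Bool // s.length = n} := fun n =>
    inferInstanceAs (Fintype (List.Vector Bool n))
  have hcard : ∀ n, Nat.card {s : List Bool // s.length = n} = 2 ^ n := fun n => by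
    have h : Nat.card (List.Vector Bool n) = 2 ^ n := by
      rw [Nat.card_eq_fintype_card, card_vector, Fintype.card_bool]
    exact h
  refine (summable_sigma_of_nonneg fun _ => pow_nonneg (by norm_num) _).2 ⟨fun n => ?_, ?_⟩
  · have := hfin n
    exact Summable.of_finite
  · have h1 : (fun n => ∑' v : {s : List Bool // s.length = n},
        (1 / 4 : ℝ) ^ (v : List Bool).length) = fun n => (1 / 2 : ℝ) ^ n := by
      funext n
      rw [tsum_congr (hlen n), tsum_const, hcard, nsmul_eq_mul]
      push_cast
      rw [← mul_pow]
      norm_num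
    exact h1 ▸ summable_geometric_of_lt_one (by norm_num) (by norm_num)

/-! ### The counterexample -/

/-- Bumps in the gaps of a self-similar Cantor set of ratio `σ ^ 2`. -/
noncomputable def wordBumps (σ : ℝ) (h0 : 0 < σ) (h4 : σ ≤ 1 / 4) : BumpFamily (List Bool) where
  z := wordCenter (σ ^ 2)
  ρ s := (σ ^ 2) ^ s.length / 4
  -- The exponent 3 makes `w / ρ` comparable to `σ ^ n`, small enough for summability, while `w`
  -- still dominates `ρ ^ 2`, comparable to `σ ^ (4 * n)`.
  w s := (σ ^ 3) ^ s.length / 8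
  k s y := 4 * (⟨(σ ^ 3) ^ s.length / 8 / 2, (σ ^ 3) ^ s.length / 8, by positivity,
    half_lt_self (by positivity)⟩ : ContDiffBump (wordCenter (σ ^ 2) s)) y
  w_pos s := by positivity
  w_le s := by
    have : (σ ^ 3) ^ s.length ≤ (σ ^ 2) ^ s.length :=
      pow_le_pow_left₀ (by positivity) (pow_le_pow_of_le_one h0.le (by linarith) (by norm_num)) _
    linarith
  disjoint s t hst := by
    rw [disjoint_left]
    intro y hs ht
    rcases wordCenter_separated (q := σ ^ 2) (by positivity) (by nlinarith) s t hst with h | h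
    · linarith [hs.2, ht.1]
    · linarith [hs.1, ht.2]
  differentiable s := ((ContDiffBump.contDiff _ (n := 1)).differentiable one_ne_zero).const_mul 4
  mem_Icc s y := by
    constructor
    · exact mul_nonneg (by norm_num) (ContDiffBump.nonneg _)
    · linarith [ContDiffBump.le_one (x := y) (⟨(σ ^ 3) ^ s.length / 8 / 2, (σ ^ 3) ^ s.length / 8,
        by positivity, half_lt_self (by positivity)⟩ : ContDiffBump (wordCenter (σ ^ 2) s))]
  eq_zero s y hy := by
    rw [ContDiffBump.zero_of_le_dist _ (by rwa [Real.dist_eq]), mul_zero]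

theorem isHKrPrimitive_wordBumps {r σ : ℝ} (hr : 1 ≤ r) (hσ : σ = 4 ^ (-r)) (h0 : 0 < σ)
    (h4 : σ ≤ 1 / 4) :
    IsHKrPrimitive r 0 1 (wordBumps σ h0 h4).derivative (wordBumps σ h0 h4).sum := by
  refine (wordBumps σ h0 h4).isHKrPrimitive_sum hr (fun _ => by positivity) summable_pow_length
    fun s => ?_
  have h1 : 4 * ((σ ^ 3) ^ s.length / 8) / ((σ ^ 2) ^ s.length / 4) = 2 * σ ^ s.length := by
    rw [show σ ^ 3 = σ ^ 2 * σ by ring, mul_pow]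
    field_simp
    norm_num
  have h2 : ((1 / 4 : ℝ) ^ s.length) ^ r = σ ^ s.length := by
    rw [hσ, ← Real.rpow_natCast, ← Real.rpow_mul (by norm_num), ← Real.rpow_natCast (4 ^ (-r)),
      ← Real.rpow_mul (by norm_num), one_div, Real.inv_rpow (by norm_num),
      ← Real.rpow_neg (by norm_num)]
    congr 1
    ring
  -- In the weights `8 * (1 / 4) ^ n`, the factor `8 = 4 * 2` matches the bump height and, through
  -- `2 ≤ 2 ^ r`, the 2 in `4 * w / ρ = 2 * σ ^ n`.
  have h3 : (2 : ℝ) ≤ 2 ^ r := by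
    simpa using Real.rpow_le_rpow_of_exponent_le (show (1 : ℝ) ≤ 2 by norm_num) hr
  change (4 : ℝ) ^ r * (4 * ((σ ^ 3) ^ s.length / 8) / ((σ ^ 2) ^ s.length / 4)) ≤ _
  rw [h1, Real.mul_rpow (by norm_num) (by positivity), h2, show (8 : ℝ) = 4 * 2 by norm_num,
    Real.mul_rpow (by norm_num) (by norm_num), mul_assoc]
  gcongr

theorem not_prIntegrable_wordBumps {σ : ℝ} (h0 : 0 < σ) (h4 : σ ≤ 1 / 4) :
    ¬ PrIntegrable 1 0 1 (wordBumps σ h0 h4).derivative := by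
  intro h
  obtain ⟨M, m, hM, hm, hMm⟩ := h 1 one_pos
  have hq0 : 0 < σ ^ 2 := by positivity
  have hq : σ ^ 2 ≤ 1 / 16 := by nlinarith
  have hmem : ∀ f, Cardinal.cantorFunction (σ ^ 2) f / 4 ∈ Ico (0 : ℝ) 1 := fun f =>
    ⟨by linarith [cantorFunction_nonneg hq0 f], by linarith [cantorFunction_lt_two hq0 hq f]⟩
  -- Otherwise the uncountable Cantor set would inject into the countable exceptional set of `m`.
  obtain ⟨f, hf⟩ : ∃ f, upperDerivate 1 0 1 m (Cardinal.cantorFunction (σ ^ 2) f / 4) < ⊤ := by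
    by_contra! hc
    have hcount := hm.derivate_lt_top.to_subtype
    have hinj : Function.Injective fun f : ℕ → Bool =>
        (⟨Cardinal.cantorFunction (σ ^ 2) f / 4, Ico_subset_Icc_self (hmem f), (hc f).not_gt⟩ :
          {x ∈ Icc (0 : ℝ) 1 | ¬ upperDerivate 1 0 1 m x < ⊤}) := by
      intro f g hfg
      refine Cardinal.cantorFunction_injective hq0 (by linarith) ?_
      have := congrArg Subtype.val hfg
      simp only at this
      linarith
    have := hinj.countable
    rw [← Cardinal.mk_le_aleph0_iff] at this
    simp only [Cardinal.mk_pi, Cardinal.mk_bool, Cardinal.prod_const, Cardinal.mk_nat] at this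
    exact absurd this (by simpa using Cardinal.cantor Cardinal.aleph0)
  obtain ⟨δ, hδ, H⟩ := BumpFamily.exists_forall_w_le hM hm hMm (hmem f) hf
  have hlim : Tendsto (fun n => (σ ^ 2) ^ n) atTop (𝓝 0) :=
    tendsto_pow_atTop_nhds_zero_of_lt_one hq0.le (by linarith)
  -- The width estimate will read `σ ^ (3 * n) / 8 ≤ σ ^ (4 * n)`; `n ≥ 2` gives `σ ^ n ≤ 1 / 16 < 1
  -- / 8`, a contradiction.
  obtain ⟨n, hn, hn2⟩ := ((hlim.eventually (gt_mem_nhds hδ)).and (eventually_ge_atTop 2)).exists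
  obtain ⟨h1, h2⟩ := cantorFunction_near_gap hq0 hq f n
  have hlen := length_wordPrefix f n
  have hw : (σ ^ 3) ^ n / 8 ≤ 16 * ((σ ^ 2) ^ n / 4) ^ 2 := by
    have := H (wordPrefix f n)
    simp only [BumpFamily.gap, wordBumps, hlen] at this
    refine this (fun y hy => ?_) (fun y hy => ?_) h1 (by linarith) (by linarith)
    · have h3 := wordCenter_mem hq0 hq (wordPrefix f n)
      rw [hlen] at h3
      exact ⟨by linarith [hy.1], by linarith [hy.2]⟩
    · rw [ContDiffBump.one_of_mem_closedBall, mul_one]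
      rwa [Metric.mem_closedBall, Real.dist_eq]
  have h3 : 16 * ((σ ^ 2) ^ n / 4) ^ 2 = (σ ^ 3) ^ n * σ ^ n := by
    ring
  have h5 : σ ^ n ≤ 1 / 16 :=
    (pow_le_pow_of_le_one h0.le (by linarith) hn2).trans (by nlinarith)
  have h6 : 0 < (σ ^ 3) ^ n := by positivity
  nlinarith

end LrIntegral

theorem mainTheorem1 (r : ℝ) (hr : 1 ≤ r) :
    ∃ f : ℝ → ℝ, LrIntegral.HKrIntegrable r 0 1 f ∧ ¬ LrIntegral.PrIntegrable 1 0 1 f := by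
  have h0 : (0 : ℝ) < 4 ^ (-r) := by positivity
  have h4 : (4 : ℝ) ^ (-r) ≤ 1 / 4 := by
    have := Real.rpow_le_rpow_of_exponent_le (show (1 : ℝ) ≤ 4 by norm_num)
      (show -r ≤ -1 by linarith)
    rwa [Real.rpow_neg_one, ← one_div] at this
  exact ⟨_, ⟨_, LrIntegral.isHKrPrimitive_wordBumps hr rfl h0 h4⟩,
    LrIntegral.not_prIntegrable_wordBumps h0 h4⟩
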